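/- **Setting.** Let $\alpha_{\rm sys}>0$. A graphical coordination game is played on a connected simple undirected graph $G$ with node set $\mathcal N=\{1,\dots,N\}$, $N\ge 3$. Each agent $i$ chooses $a_i\in\{x,y\}$. For a gain $\alpha>0$ let $V^\alpha(x,x)=1+\alpha$, $V^\alpha(y,y)=1$, $V^\alpha(x,y)=V^\alpha(y,x)=0$, $U_i^\alpha(a)=\sum_{j\sim i}V^\alpha(a_i,a_j)$, and let $W(a)=\sum_i U_i^{\alpha_{\rm sys}}(a)$ be the welfare. Given action sets $\mathcal A_i\subseteq\{x,y\}$, $\mathcal A=\prod_i\mathcal A_i$, and utilities $U_i$, log-linear learning with parameter $\beta>0$ is the Markov chain on $\mathcal A$ in which at each step a uniformly random agent $i$ switches to $z\in\mathcal A_i$ with probability proportional to $\exp(\beta U_i(z,a_{-i}))$, while the others keep their actions. With $\pi_\beta$ its stationary distribution, $\mathrm{LLL}(\mathcal A,\{U_i\};G)$ is the set of $a\in\mathcal A$ with $\lim_{\beta\to\infty}\pi_\beta(a)>0$ (the stochastically stable states). *Broad attacks.* A target set is a partition $S=(S_x,S_y)$ of $\mathcal N$ into two disjoint (possibly empty)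 sets; the perceived utility $\tilde U_i^{\alpha}$ is $U_i^\alpha(a)+\mathbf 1(a_i=y)$ for $i\in S_y$ and $U_i^\alpha(a)+(1+\alpha)\mathbf 1(a_i=x)$ for $i\in S_x$. The broad risk is $$R_b(\alpha,S;G)=1-\frac{\min_{a\in \mathrm{LLL}(\{x,y\}^N,\{\tilde U_i^\alpha\};G)}W(a)}{\max_{a\in\{x,y\}^N}W(a)} .$$ *Focused attacks.* A fixed set is a pair $F=(F_x,F_y)$ of disjoint sets with $\varnothing\ne F_x\cup F_y\subsetneq\mathcal N$; agents in $F_x$ (resp. $F_y$) have the action set $\{x\}$ (resp. $\{y\}$), all others $\{x,y\}$, and $\mathcal A(F)$ is the product of these. The focused risk is $$R_f(\alpha,F;G)=1-\frac{\min_{a\in \mathrm{LLL}(\mathcal A(F),\{U_i^\alpha\};G)}W(a)}{\max_{a\in\mathcal A(F)}W(a)} .$$ Let $R_b^*(\alpha)$ be the supremum of $R_b(\alpha,S;G)$ over all $N\ge3$, connected $G$ on $N$ nodes and target sets $S$, and $R_f^*(\alpha)$ the supremum of $R_f(\alpha,F;G)$ over all $N\ge3$, connected $G$ and fixed sets $F$.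 Let $M\ge1$, let $\boldsymbol\alpha=(\alpha_1,\dots,\alpha_M)$ be gains with $\alpha_{\rm sys}\le\alpha_1<\dots<\alpha_M$, and let $\Delta_M$ be the set of probability vectors in $\mathbb R^M$. For $\boldsymbol p\in\Delta_M$ the worst-case expected risks are $$\mathbb E^*_{\boldsymbol\alpha,\boldsymbol p}[R_b]=\sup_{N\ge3,\,G,\,S}\ \sum_{j=1}^M p_jR_b(\alpha_j,S;G),\qquad \mathbb E^*_{\boldsymbol\alpha,\boldsymbol p}[R_f]=\sup_{N\ge3,\,G,\,F}\ \sum_{j=1}^M p_jR_f(\alpha_j,F;G).$$ **Statement.** For $\gamma_f\in[R_f^*(\alpha_1),1]$ consider the linear program $$v_b(\gamma_f,\boldsymbol\alpha)=\min_{\boldsymbol p',v}\ v\quad\text{s.t.}\quad \sum_{i=1}^M p_i'=1,\ \ p_i'\ge0\ \forall i,\ \ v\in[0,1],\ \ A_{\rm LP}\begin{bmatrix}\boldsymbol p'\\ v\end{bmatrix}\preceq\begin{bmatrix}0_M\\ \gamma_f\mathbf 1_M\end{bmatrix},\qquad A_{\rm LP}=\begin{bmatrix}A_b&-\mathbf 1_M\\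 A_f&0_M\end{bmatrix}\in\mathbb R^{2M\times(M+1)},$$ where $\preceq$ is the elementwise order, $(A_b)_{ij}=R_b^*(\alpha_i)$ if $j\le i$ and $0$ otherwise, and $(A_f)_{ij}=R_f^*(\alpha_i)$ if $j\ge i$ and $0$ otherwise. Then for every $\gamma_f\in[R_f^*(\alpha_1),1]$ the minimum is attained, and for every $\boldsymbol p\in\Delta_M$ with $\mathbb E^*_{\boldsymbol\alpha,\boldsymbol p}[R_f]\le\gamma_f$, $$\mathbb E^*_{\boldsymbol\alpha,\boldsymbol p}[R_b]\ \ge\ v_b(\gamma_f,\boldsymbol\alpha).$$ Moreover, $v_b(\gamma_f,\boldsymbol\alpha)$ is nonincreasing in $\gamma_f\in[R_f^*(\alpha_1),1]$. -/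

import Mathlib

open Filter Topology

namespace CoordGame

noncomputable section

/-- The two choices available to an agent. -/
inductive Action where
  | x : Action
  | y : Action
  deriving DecidableEq

instance : Fintype Action where
  elems := {.x, .y}
  complete a := by cases a <;> simp

/-- Row player's payoff in the `2 × 2` base game with payoff gain `α`. -/
def payoff (α : ℝ) : Action → Action → ℝ
  | .x, .x => 1 + α
  | .y, .y => 1
  | _, _ => 0

section Game

variable {V : Type} [Fintype V]

open Classical in
/-- The benefit of agent `i`: the payoffs it derives from its neighbours, with payoff gain `α`. -/
def benefit (G : SimpleGraph V) (α : ℝ) (i : V) (a : V → Action) : ℝ :=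
  ∑ j ∈ Finset.univ.filter (fun j => G.Adj i j), payoff α (a i) (a j)

/-- Welfare: the sum of all agents' benefits. -/
def welfare (G : SimpleGraph V) (α : ℝ) (a : V → Action) : ℝ :=
  ∑ i, benefit G α i a

variable [DecidableEq V]

/-- The action profiles `∏ i, 𝒜 i`, where `𝒜 i` is the action set of agent `i`. -/
abbrev profiles (𝒜 : V → Finset Action) : Finset (V → Action) := Fintype.piFinset 𝒜

/-- The transition matrix of log-linear learning with rationality parameter `β`: an agent `i` is
drawn uniformly at random and changes its action to `z ∈ 𝒜 i` with probability proportional to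
`exp (β * U i (z, a₋ᵢ))`; all other agents repeat their actions. The entry `(a, b)` is the
probability of moving from `a` to `b`; only those `i` contribute for which `a` and `b` agree off
`i`. -/
def transition (𝒜 : V → Finset Action) (U : V → (V → Action) → ℝ) (β : ℝ) :
    Matrix (profiles 𝒜) (profiles 𝒜) ℝ :=
  fun a b => ∑ i, (1 / (Fintype.card V : ℝ)) *
    (if Function.update a.1 i (b.1 i) = b.1 then
      Real.exp (β * U i (Function.update a.1 i (b.1 i))) /
        ∑ z ∈ 𝒜 i, Real.exp (β * U i (Function.update a.1 i z))
    else 0)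

/-- `π` is a stationary probability distribution of the transition matrix `P`. -/
def IsStationary {S : Type} [Fintype S] (P : Matrix S S ℝ) (π : S → ℝ) : Prop :=
  π ∈ stdSimplex ℝ S ∧ Matrix.vecMul π P = π

/-- The stochastically stable states of log-linear learning: the profiles whose stationary
probability has a positive limit as `β → ∞`. (The chain is irreducible, so that its stationary
distribution `π β` is the only one.) -/
def LLL (𝒜 : V → Finset Action) (U : V → (V → Action) → ℝ) : Set (V → Action) :=
  {a | ∃ ha : a ∈ profiles 𝒜, ∃ π : ℝ → profiles 𝒜 → ℝ,
    (∀ β, 0 < β → IsStationary (transition 𝒜 U β) (π β)) ∧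
    ∃ l : ℝ, 0 < l ∧ Tendsto (fun β => π β ⟨a, ha⟩) atTop (𝓝 l)}

/-- A target set of a broad attack: every agent gets exactly one imposter, an `x`-imposter on `Sx`
and a `y`-imposter on `Sy`. -/
structure TargetSet (V : Type) [Fintype V] [DecidableEq V] where
  Sx : Finset V
  Sy : Finset V
  disjoint : Disjoint Sx Sy
  cover : Sx ∪ Sy = Finset.univ

/-- Perceived utilities under a broad attack. -/
def perceivedUtility (G : SimpleGraph V) (S : TargetSet V) (α : ℝ) (i : V) (a : V → Action) : ℝ :=
  benefit G α i a + (if i ∈ S.Sy ∧ a i = .y then 1 else 0)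
    + (if i ∈ S.Sx ∧ a i = .x then 1 + α else 0)

/-- The unrestricted action sets. -/
def fullActions : V → Finset Action := fun _ => Finset.univ

/-- Efficiency under a broad attack, at the worst stochastically stable state. The infimum and the
supremum are over finite non-empty sets. -/
def broadEfficiency (G : SimpleGraph V) (S : TargetSet V) (αsys α : ℝ) : ℝ :=
  sInf (welfare G αsys '' LLL fullActions (perceivedUtility G S α)) /
    sSup (welfare G αsys '' (profiles (fullActions : V → Finset Action) : Set (V → Action)))

/-- Risk from a broad attack. -/
def broadRisk (G : SimpleGraph V) (S : TargetSet V) (αsys α : ℝ) : ℝ :=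
  1 - broadEfficiency G S αsys α

/-- A fixed set of a focused attack: at least one agent, but not all of them, is fixed to `x` or to
`y`. -/
structure FixedSet (V : Type) [Fintype V] [DecidableEq V] where
  Fx : Finset V
  Fy : Finset V
  disjoint : Disjoint Fx Fy
  nonempty : (Fx ∪ Fy).Nonempty
  strict : Fx ∪ Fy ⊂ Finset.univ

/-- The action sets under a focused attack. -/
def FixedSet.actions (F : FixedSet V) (i : V) : Finset Action :=
  if i ∈ F.Fx then {.x} else if i ∈ F.Fy then {.y} else Finset.univ

/-- Efficiency under a focused attack, at the worst stochastically stable state, relative to the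
best welfare among the profiles that respect the fixed agents. -/
def focusedEfficiency (G : SimpleGraph V) (F : FixedSet V) (αsys α : ℝ) : ℝ :=
  sInf (welfare G αsys '' LLL F.actions (benefit G α)) /
    sSup (welfare G αsys '' (profiles F.actions : Set (V → Action)))

/-- Risk from a focused attack. -/
def focusedRisk (G : SimpleGraph V) (F : FixedSet V) (αsys α : ℝ) : ℝ :=
  1 - focusedEfficiency G F αsys α

end Game

/-- Worst-case broad risk of the gain `α`, over all connected graphs on `N ≥ 3` nodes and all
target sets. (Risks lie in `[0, 1]`, so that this supremum, like those below, is a genuine one.) -/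
def worstBroad (αsys α : ℝ) : ℝ :=
  sSup {r : ℝ | ∃ N : ℕ, 3 ≤ N ∧ ∃ G : SimpleGraph (Fin N), G.Connected ∧
    ∃ S : TargetSet (Fin N), r = broadRisk G S αsys α}

/-- Worst-case focused risk of the gain `α`. -/
def worstFocused (αsys α : ℝ) : ℝ :=
  sSup {r : ℝ | ∃ N : ℕ, 3 ≤ N ∧ ∃ G : SimpleGraph (Fin N), G.Connected ∧
    ∃ F : FixedSet (Fin N), r = focusedRisk G F αsys α}

variable {M : ℕ}

/-- Worst-case expected broad risk when gain `α j` is used with probability `p j`. -/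
def worstExpectedBroad (αsys : ℝ) (α p : Fin M → ℝ) : ℝ :=
  sSup {r : ℝ | ∃ N : ℕ, 3 ≤ N ∧ ∃ G : SimpleGraph (Fin N), G.Connected ∧
    ∃ S : TargetSet (Fin N), r = ∑ j, p j * broadRisk G S αsys (α j)}

/-- Worst-case expected focused risk when gain `α j` is used with probability `p j`. -/
def worstExpectedFocused (αsys : ℝ) (α p : Fin M → ℝ) : ℝ :=
  sSup {r : ℝ | ∃ N : ℕ, 3 ≤ N ∧ ∃ G : SimpleGraph (Fin N), G.Connected ∧
    ∃ F : FixedSet (Fin N), r = ∑ j, p j * focusedRisk G F αsys (α j)}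

/-- Upper left block of the constraint matrix: row `i` is `R_b^*(α i)` up to the diagonal. -/
def Ab (αsys : ℝ) (α : Fin M → ℝ) : Matrix (Fin M) (Fin M) ℝ :=
  Matrix.of fun i j => if j ≤ i then worstBroad αsys (α i) else 0

/-- Lower left block of the constraint matrix: row `i` is `R_f^*(α i)` from the diagonal on. -/
def Af (αsys : ℝ) (α : Fin M → ℝ) : Matrix (Fin M) (Fin M) ℝ :=
  Matrix.of fun i j => if i ≤ j then worstFocused αsys (α i) else 0

/-- The `2M × (M + 1)` constraint matrix. -/
def ALP (αsys : ℝ) (α : Fin M → ℝ) : Matrix (Fin M ⊕ Fin M) (Fin M ⊕ Unit) ℝ :=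
  Matrix.fromBlocks (Ab αsys α) (Matrix.of fun _ _ => -1) (Af αsys α) 0

/-- The feasible points `(p', v)` of the linear program. -/
def feasible (αsys γ : ℝ) (α : Fin M → ℝ) : Set ((Fin M → ℝ) × ℝ) :=
  {q | ∑ i, q.1 i = 1 ∧ (∀ i, 0 ≤ q.1 i) ∧ q.2 ∈ Set.Icc (0 : ℝ) 1 ∧
    Matrix.mulVec (ALP αsys α) (Sum.elim q.1 (fun _ => q.2)) ≤
      Sum.elim (fun _ => 0) (fun _ => γ)}

/-- The values `v` of the objective on the feasible points. -/
def objectiveValues (αsys γ : ℝ) (α : Fin M → ℝ) : Set ℝ :=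
  Prod.snd '' feasible αsys γ α

/-- The value `v_b(γ, α)` of the linear program. -/
def vb (αsys γ : ℝ) (α : Fin M → ℝ) : ℝ := sInf (objectiveValues αsys γ α)

end

end CoordGame

/-! For a distribution `p`, the pair consisting of `p` and its worst-case expected broad risk is
feasible for the linear program, so the minimum lies below that risk. The minimum exists because the
feasible set is compact and nonempty, and it is nonincreasing because raising `γ` only enlarges that
set. Feasibility is two families of inequalities. For focused attacks (`sum_mul_worstFocused_le`)
the same attack is no less harmful to larger gains: a larger gain selects stable states with more
`x`-`x` edges, and these have no more welfare for `αsys` (`focusedRisk_mono`). For broad attacks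
(`sum_mul_worstBroad_le`) the attack must first be rebuilt on another graph (`exists_broadRisk_le`).
Take a worst stable state, pick a component `K` of its `y`-players, keep the edges leaving `K` as
pendant edges, and put `y`-imposters on `K` and `x`-imposters on the leaves. By averaging, some `K`
makes the new graph at most as efficient as the old state. The profile with `y` on `K` and `x` on
the leaves remains stable when the gain decreases. Both rest on `mem_LLL_iff`: in a potential game
the Gibbs distribution is the unique stationary one, so the stochastically stable states are the
potential maximizers. -/

namespace CoordGame

/-! ### Log-linear learning in potential games. -/

/-- A distribution fixed by an irreducible reversible chain is proportional to the reversing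
measure. -/
theorem eq_smul_of_reversible {S : Type} [Fintype S] [Nonempty S] {P : Matrix S S ℝ} {μ π : S → ℝ}
    (hμ : ∀ a, 0 < μ a) (hrev : ∀ a b, μ a * P a b = μ b * P b a)
    (hrow : ∀ a, ∑ b, P a b = 1) (hnn : ∀ a b, 0 ≤ P a b)
    (hirr : ∀ T : Set S, T.Nonempty → (∀ a ∈ T, ∀ b, 0 < P a b → b ∈ T) → T = Set.univ)
    (hπ : Matrix.vecMul π P = π) : ∃ c, ∀ a, π a = c * μ a := by
  set h : S → ℝ := fun a => π a / μ a with hh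
  -- Stationarity and detailed balance together make the density `π / μ` harmonic.
  have harm : ∀ a, ∑ b, P a b * h b = h a := by
    intro a
    have h1 : ∑ b, π b * P b a = π a := congrFun hπ a
    simp only [hh]
    rw [← h1, Finset.sum_div]
    refine Finset.sum_congr rfl fun b _ => ?_
    have := hrev a b
    have ha := (hμ a).ne'
    have hb := (hμ b).ne'
    field_simp
    linear_combination π b * this
  obtain ⟨m, hm⟩ := Finite.exists_max h
  -- Maximum principle: the set where `h` is maximal is closed under positive transitions, hence
  -- everything.
  have hT := hirr {a | ∀ b, h b ≤ h a} ⟨m, hm⟩ (by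
    intro a ha b hab
    suffices h b = h a by intro c; rw [this]; exact ha c
    by_contra hne
    have hlt : h b < h a := lt_of_le_of_ne (ha b) hne
    have : ∑ c, P a c * h c < ∑ c, P a c * h a :=
      Finset.sum_lt_sum (fun c _ => mul_le_mul_of_nonneg_left (ha c) (hnn a c))
        ⟨b, Finset.mem_univ _, mul_lt_mul_of_pos_left hlt hab⟩
    rw [harm a, ← Finset.sum_mul, hrow a, one_mul] at this
    exact lt_irrefl _ this)
  refine ⟨h m, fun a => ?_⟩
  have ha : a ∈ {a | ∀ b, h b ≤ h a} := hT ▸ Set.mem_univ a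
  rw [le_antisymm (ha m) (hm a)]
  exact (div_mul_cancel₀ _ (hμ a).ne').symm

section Potential

variable {V : Type} [Fintype V] [DecidableEq V] {𝒜 : V → Finset Action}
  {U : V → (V → Action) → ℝ} {Φ : (V → Action) → ℝ}

/-- `Φ` is an exact potential of the game with utilities `U`. -/
def IsPotential (U : V → (V → Action) → ℝ) (Φ : (V → Action) → ℝ) : Prop :=
  ∀ a i z, U i (Function.update a i z) - U i a = Φ (Function.update a i z) - Φ a

theorem transition_nonneg (β : ℝ) (a b : profiles 𝒜) : 0 ≤ transition 𝒜 U β a b := by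
  unfold transition
  refine Finset.sum_nonneg fun i _ => mul_nonneg (by positivity) ?_
  split_ifs <;> positivity

theorem update_mem_profiles {a : V → Action} (ha : a ∈ profiles 𝒜) {i : V} {z : Action}
    (hz : z ∈ 𝒜 i) : Function.update a i z ∈ profiles 𝒜 := by
  rw [Fintype.mem_piFinset] at ha ⊢
  intro j
  by_cases h : j = i
  · subst h; simpa using hz
  · simpa [h] using ha j

theorem sum_exp_pos (β : ℝ) (a : profiles 𝒜) (i : V) :
    0 < ∑ z ∈ 𝒜 i, Real.exp (β * U i (Function.update a.1 i z)) :=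
  Finset.sum_pos (fun _ _ => Real.exp_pos _) ⟨a.1 i, Fintype.mem_piFinset.1 a.2 i⟩

theorem transition_row_sum [Nonempty V] (β : ℝ) (a : profiles 𝒜) :
    ∑ b, transition 𝒜 U β a b = 1 := by
  unfold transition
  rw [Finset.sum_comm]
  have key : ∀ i : V, ∑ b : profiles 𝒜, (1 / (Fintype.card V : ℝ)) *
      (if Function.update a.1 i (b.1 i) = b.1 then
      Real.exp (β * U i (Function.update a.1 i (b.1 i))) /
        ∑ z ∈ 𝒜 i, Real.exp (β * U i (Function.update a.1 i z))
      else 0) = 1 / (Fintype.card V : ℝ) := by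
    intro i
    rw [← Finset.mul_sum, ← Finset.sum_filter]
    have : ∑ b : profiles 𝒜 with Function.update a.1 i (b.1 i) = b.1,
        Real.exp (β * U i (Function.update a.1 i (b.1 i))) /
        ∑ z ∈ 𝒜 i, Real.exp (β * U i (Function.update a.1 i z)) =
        ∑ w ∈ 𝒜 i, Real.exp (β * U i (Function.update a.1 i w)) /
        ∑ z ∈ 𝒜 i, Real.exp (β * U i (Function.update a.1 i z)) := by
      -- Profiles agreeing with `a` off `i` correspond to actions of `i`; the branch `else a` is
      -- never reached.
      refine Finset.sum_bij' (fun b _ => b.1 i)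
        (fun z hz => if h : z ∈ 𝒜 i then ⟨_, update_mem_profiles a.2 h⟩ else a) ?_ ?_ ?_ ?_ ?_
      · intro b _
        exact Fintype.mem_piFinset.1 b.2 i
      · intro z hz
        simp [hz]
      · intro b hb
        have hbi := Fintype.mem_piFinset.1 b.2 i
        simp only [Finset.mem_filter] at hb
        simp only [hbi, dif_pos]
        exact Subtype.ext hb.2
      · intro z hz
        simp [hz]
      · intro b _
        rfl
    rw [this, ← Finset.sum_div, div_self (sum_exp_pos β a i).ne', mul_one]
  rw [Finset.sum_congr rfl fun i _ => key i]
  simp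

theorem transition_update_pos [Nonempty V] (β : ℝ) (a b : profiles 𝒜) (i : V)
    (hab : Function.update a.1 i (b.1 i) = b.1) : 0 < transition 𝒜 U β a b := by
  unfold transition
  have hc : (0 : ℝ) < 1 / (Fintype.card V : ℝ) := by
    have : 0 < Fintype.card V := Fintype.card_pos
    positivity
  refine Finset.sum_pos' (fun j _ => mul_nonneg hc.le ?_) ⟨i, Finset.mem_univ _, mul_pos hc ?_⟩
  · split_ifs <;> positivity
  · rw [if_pos hab]
    exact div_pos (Real.exp_pos _) (sum_exp_pos β a i)

/-- Any profile is reached from any other by switching the agents one at a time; action sets form a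
product, so the intermediate profiles are admissible. -/
theorem transition_irreducible [Nonempty V] (β : ℝ) (T : Set (profiles 𝒜)) (hT : T.Nonempty)
    (hcl : ∀ a ∈ T, ∀ b, 0 < transition 𝒜 U β a b → b ∈ T) : T = Set.univ := by
  obtain ⟨a, ha⟩ := hT
  refine Set.eq_univ_of_forall fun b => ?_
  have key : ∀ s : Finset V, ∃ h : s.piecewise b.1 a.1 ∈ profiles 𝒜,
      (⟨s.piecewise b.1 a.1, h⟩ : profiles 𝒜) ∈ T := by
    intro s
    induction s using Finset.induction_on with
    | empty => simpa using ha
    | insert i s hi ih =>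
      obtain ⟨h, hs⟩ := ih
      have h' : (insert i s).piecewise b.1 a.1 ∈ profiles 𝒜 := by
        rw [Finset.piecewise_insert]
        exact update_mem_profiles h (Fintype.mem_piFinset.1 b.2 i)
      refine ⟨h', hcl _ hs _ (transition_update_pos β _ _ i ?_)⟩
      simp [Finset.piecewise_insert]
  obtain ⟨h, hs⟩ := key Finset.univ
  simpa using hs

/-- Balance holds agent by agent: profiles agreeing off `i` share the normalizing sum, and their
utilities differ by the potential difference. -/
theorem transition_reversible (hΦ : IsPotential U Φ) (β : ℝ) (a b : profiles 𝒜) :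
    Real.exp (β * Φ a) * transition 𝒜 U β a b = Real.exp (β * Φ b) * transition 𝒜 U β b a := by
  unfold transition
  rw [Finset.mul_sum, Finset.mul_sum]
  refine Finset.sum_congr rfl fun i _ => ?_
  by_cases hab : Function.update a.1 i (b.1 i) = b.1
  · have hz : ∀ z, Function.update b.1 i z = Function.update a.1 i z := by
      intro z; rw [← hab]; simp
    have hba : Function.update b.1 i (a.1 i) = a.1 := by rw [hz]; simp
    rw [if_pos hab, if_pos hba, hab, hba]
    simp only [hz]
    have h1 := hΦ a.1 i (b.1 i)
    rw [hab] at h1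
    have h2 : Real.exp (β * Φ a) * Real.exp (β * U i b) =
        Real.exp (β * Φ b) * Real.exp (β * U i a) := by
      rw [← Real.exp_add, ← Real.exp_add]
      congr 1
      linear_combination β * h1
    simp only [div_eq_mul_inv]
    linear_combination (1 * ((Fintype.card V : ℝ))⁻¹ *
      (∑ z ∈ 𝒜 i, Real.exp (β * U i (Function.update a.1 i z)))⁻¹) * h2
  · have hba : ¬ Function.update b.1 i (a.1 i) = a.1 := by
      intro h
      apply hab
      rw [← h]; simp
    rw [if_neg hab, if_neg hba]
    simp

/-- The Gibbs distribution of a potential. -/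
noncomputable def gibbs (𝒜 : V → Finset Action) (Φ : (V → Action) → ℝ) (β : ℝ)
    (a : profiles 𝒜) : ℝ :=
  Real.exp (β * Φ a) / ∑ b : profiles 𝒜, Real.exp (β * Φ b)

theorem partition_pos [Nonempty (profiles 𝒜)] (β : ℝ) :
    0 < ∑ b : profiles 𝒜, Real.exp (β * Φ b) :=
  Finset.sum_pos (fun _ _ => Real.exp_pos _) Finset.univ_nonempty

theorem gibbs_mem_stdSimplex [Nonempty (profiles 𝒜)] (β : ℝ) :
    gibbs 𝒜 Φ β ∈ stdSimplex ℝ (profiles 𝒜) := by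
  refine ⟨fun a => div_nonneg (Real.exp_pos _).le (partition_pos β).le, ?_⟩
  unfold gibbs
  rw [← Finset.sum_div, div_self (partition_pos β).ne']

theorem isStationary_iff_gibbs [Nonempty V] [Nonempty (profiles 𝒜)] (hΦ : IsPotential U Φ) (β : ℝ)
    (π : profiles 𝒜 → ℝ) : IsStationary (transition 𝒜 U β) π ↔ π = gibbs 𝒜 Φ β := by
  have hrev : ∀ a b, gibbs 𝒜 Φ β a * transition 𝒜 U β a b =
      gibbs 𝒜 Φ β b * transition 𝒜 U β b a := by
    intro a b
    have := transition_reversible (𝒜 := 𝒜) hΦ β a b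
    simp only [gibbs, div_mul_eq_mul_div, this]
  constructor
  · rintro ⟨hs, hfix⟩
    obtain ⟨c, hc⟩ := eq_smul_of_reversible
      (fun a => div_pos (Real.exp_pos _) (partition_pos β)) hrev (transition_row_sum β)
      (transition_nonneg β) (transition_irreducible β) hfix
    have h1 := hs.2
    simp only [hc] at h1
    rw [← Finset.mul_sum] at h1
    have h2 := (gibbs_mem_stdSimplex (𝒜 := 𝒜) (Φ := Φ) β).2
    have hc1 : c = 1 := by
      have h3 : c * ∑ a, gibbs 𝒜 Φ β a = 1 := h1
      rwa [h2, mul_one] at h3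
    funext a
    rw [hc a, hc1, one_mul]
    rfl
  · rintro rfl
    refine ⟨gibbs_mem_stdSimplex β, ?_⟩
    funext b
    change ∑ a, gibbs 𝒜 Φ β a * transition 𝒜 U β a b = _
    simp only [hrev _ b]
    rw [← Finset.mul_sum, transition_row_sum, mul_one]

/-- In this form the limit is visible: at a maximizer each summand tends to 0 or 1, elsewhere some
summand blows up. -/
theorem gibbs_eq_inv (β : ℝ) (a : profiles 𝒜) :
    gibbs 𝒜 Φ β a = (∑ b : profiles 𝒜, Real.exp (β * (Φ b - Φ a)))⁻¹ := by
  unfold gibbs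
  have : ∀ b : profiles 𝒜, Real.exp (β * (Φ b - Φ a)) =
      Real.exp (β * Φ b) / Real.exp (β * Φ a) := by
    intro b; rw [← Real.exp_sub]; congr 1; ring
  simp only [this]
  rw [← Finset.sum_div, inv_div]

theorem tendsto_exp_mul_of_neg {c : ℝ} (hc : c < 0) :
    Tendsto (fun β : ℝ => Real.exp (β * c)) atTop (𝓝 0) :=
  Real.tendsto_exp_atBot.comp (tendsto_id.atTop_mul_const_of_neg hc)

theorem tendsto_gibbs_of_isMax (a : profiles 𝒜) (ha : ∀ b : profiles 𝒜, Φ b ≤ Φ a) :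
    ∃ l : ℝ, 0 < l ∧ Tendsto (fun β => gibbs 𝒜 Φ β a) atTop (𝓝 l) := by
  classical
  have h1 : ∀ b : profiles 𝒜, Tendsto (fun β : ℝ => Real.exp (β * (Φ b - Φ a))) atTop
      (𝓝 (if Φ b = Φ a then 1 else 0)) := by
    intro b
    split_ifs with h
    · simp [h]
    · exact tendsto_exp_mul_of_neg (sub_neg.2 (lt_of_le_of_ne (ha b) h))
  have h2 := tendsto_finsetSum Finset.univ fun b _ => h1 b
  have hpos : (0 : ℝ) < ∑ b : profiles 𝒜, if Φ b = Φ a then (1 : ℝ) else 0 :=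
    Finset.sum_pos' (fun b _ => by split_ifs <;> norm_num) ⟨a, Finset.mem_univ _, by simp⟩
  refine ⟨_, inv_pos.2 hpos, ?_⟩
  simp only [gibbs_eq_inv]
  exact h2.inv₀ hpos.ne'

theorem tendsto_gibbs_of_lt (a b : profiles 𝒜) (hab : Φ a < Φ b) :
    Tendsto (fun β => gibbs 𝒜 Φ β a) atTop (𝓝 0) := by
  refine tendsto_of_tendsto_of_tendsto_of_le_of_le tendsto_const_nhds
    (tendsto_exp_mul_of_neg (sub_neg.2 hab)) (fun β => ?_) (fun β => ?_)
  · exact div_nonneg (Real.exp_pos _).le (Finset.sum_nonneg fun _ _ => (Real.exp_pos _).le)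
  · have h : Real.exp (β * (Φ b - Φ a)) ≤ ∑ b : profiles 𝒜, Real.exp (β * (Φ b - Φ a)) :=
      Finset.single_le_sum (f := fun b : profiles 𝒜 => Real.exp (β * (Φ b - Φ a)))
        (fun _ _ => (Real.exp_pos _).le) (Finset.mem_univ b)
    simp only [gibbs_eq_inv]
    refine (inv_anti₀ (Real.exp_pos _) h).trans ?_
    rw [← Real.exp_neg]
    exact le_of_eq (by congr 1; ring)

/-- In a potential game the stochastically stable states of log-linear learning are the maximizers
of the potential. -/
theorem mem_LLL_iff [Nonempty V] (hΦ : IsPotential U Φ) (a : V → Action) :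
    a ∈ LLL 𝒜 U ↔ a ∈ profiles 𝒜 ∧ ∀ b ∈ profiles 𝒜, Φ b ≤ Φ a := by
  constructor
  · rintro ⟨ha, π, hπ, l, hl, hlim⟩
    have : Nonempty (profiles 𝒜) := ⟨⟨a, ha⟩⟩
    refine ⟨ha, fun b hb => ?_⟩
    by_contra hlt
    have h0 := tendsto_gibbs_of_lt (Φ := Φ) ⟨a, ha⟩ ⟨b, hb⟩ (not_le.1 hlt)
    -- Stationarity is known only for positive `β`, so `π` is Gibbs only eventually.
    have heq : (fun β => gibbs 𝒜 Φ β ⟨a, ha⟩) =ᶠ[atTop] fun β => π β ⟨a, ha⟩ := by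
      filter_upwards [eventually_gt_atTop (0 : ℝ)] with β hβ
      rw [(isStationary_iff_gibbs hΦ β _).1 (hπ β hβ)]
    exact hl.ne (tendsto_nhds_unique (h0.congr' heq) hlim)
  · rintro ⟨ha, hmax⟩
    have : Nonempty (profiles 𝒜) := ⟨⟨a, ha⟩⟩
    exact ⟨ha, gibbs 𝒜 Φ, fun β _ => (isStationary_iff_gibbs hΦ β _).2 rfl,
      tendsto_gibbs_of_isMax ⟨a, ha⟩ fun b => hmax b.1 b.2⟩

theorem LLL_nonempty [Nonempty V] (hΦ : IsPotential U Φ) (h𝒜 : (profiles 𝒜).Nonempty) :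
    (LLL 𝒜 U).Nonempty := by
  obtain ⟨a, ha, hmax⟩ := (profiles 𝒜).exists_max_image Φ h𝒜
  exact ⟨a, (mem_LLL_iff hΦ a).2 ⟨ha, hmax⟩⟩

end Potential

end CoordGame

namespace CoordGame

/-! ### Welfare as a sum over ordered pairs, and the potentials of both attacks. -/

section Welfare

variable {V : Type}

open Classical in
/-- The indicator of adjacency. -/
noncomputable def edge (G : SimpleGraph V) (i j : V) : ℝ := if G.Adj i j then 1 else 0

theorem edge_nonneg (G : SimpleGraph V) (i j : V) : 0 ≤ edge G i j := by
  unfold edge; split_ifs <;> norm_num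

theorem edge_symm (G : SimpleGraph V) (i j : V) : edge G i j = edge G j i := by
  by_cases h : G.Adj i j
  · simp [edge, h, h.symm]
  · simp [edge, h, mt G.adj_symm h]

theorem edge_self (G : SimpleGraph V) (i : V) : edge G i i = 0 := by
  simp [edge]

theorem edge_of_adj {G : SimpleGraph V} {i j : V} (h : G.Adj i j) : edge G i j = 1 := if_pos h

theorem edge_of_not_adj {G : SimpleGraph V} {i j : V} (h : ¬ G.Adj i j) : edge G i j = 0 :=
  if_neg h

theorem payoff_symm (α : ℝ) (z w : Action) : payoff α z w = payoff α w z := by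
  cases z <;> cases w <;> rfl

theorem payoff_nonneg {α : ℝ} (hα : 0 ≤ α) (z w : Action) : 0 ≤ payoff α z w := by
  cases z <;> cases w <;> simp [payoff]
  linarith

theorem payoff_le {α : ℝ} (hα : 0 ≤ α) (z w : Action) : payoff α z w ≤ 1 + α := by
  cases z <;> cases w <;> simp [payoff] <;> linarith

variable [Fintype V]

theorem benefit_eq_sum (G : SimpleGraph V) (α : ℝ) (i : V) (a : V → Action) :
    benefit G α i a = ∑ j, edge G i j * payoff α (a i) (a j) := by
  unfold benefit edge
  rw [Finset.sum_filter]
  simp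

theorem welfare_eq_sum (G : SimpleGraph V) (α : ℝ) (a : V → Action) :
    welfare G α a = ∑ i, ∑ j, edge G i j * payoff α (a i) (a j) := by
  simp only [welfare, benefit_eq_sum]

theorem welfare_nonneg (G : SimpleGraph V) {α : ℝ} (hα : 0 ≤ α) (a : V → Action) :
    0 ≤ welfare G α a := by
  rw [welfare_eq_sum]
  exact Finset.sum_nonneg fun i _ => Finset.sum_nonneg fun j _ =>
    mul_nonneg (edge_nonneg _ _ _) (payoff_nonneg hα _ _)

theorem welfare_const_x (G : SimpleGraph V) (α : ℝ) :
    welfare G α (fun _ => .x) = (1 + α) * ∑ i, ∑ j, edge G i j := by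
  simp only [welfare_eq_sum, payoff, Finset.mul_sum]
  simp only [mul_comm]

theorem welfare_le_const_x (G : SimpleGraph V) {α : ℝ} (hα : 0 ≤ α) (a : V → Action) :
    welfare G α a ≤ welfare G α (fun _ => .x) := by
  simp only [welfare_eq_sum]
  exact Finset.sum_le_sum fun i _ => Finset.sum_le_sum fun j _ =>
    mul_le_mul_of_nonneg_left (payoff_le hα _ _) (edge_nonneg _ _ _)

/-- Twice the number of edges whose ends both play `x`. -/
noncomputable def matchX (G : SimpleGraph V) (a : V → Action) : ℝ :=
  ∑ i, ∑ j, edge G i j * (if a i = .x ∧ a j = .x then 1 else 0)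

/-- The gain enters only through `x`-`x` edges, so welfare is affine in it with slope `matchX`. -/
theorem welfare_sub (G : SimpleGraph V) (α α' : ℝ) (a : V → Action) :
    welfare G α a - welfare G α' a = (α - α') * matchX G a := by
  simp only [welfare_eq_sum, matchX, Finset.mul_sum, ← Finset.sum_sub_distrib]
  refine Finset.sum_congr rfl fun i _ => Finset.sum_congr rfl fun j _ => ?_
  cases a i <;> cases a j <;> simp [payoff]
  ring

variable [DecidableEq V]

/-- The sum of a symmetric function over all pairs, split according to membership in `K`. -/
theorem sum_sum_of_symm (K : Finset V) (δ : V → V → ℝ) (hs : ∀ i j, δ i j = δ j i) :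
    ∑ i, ∑ j, δ i j = ∑ i ∈ K, ∑ j ∈ K, δ i j + 2 * ∑ i ∈ K, ∑ j ∈ Kᶜ, δ i j +
      ∑ i ∈ Kᶜ, ∑ j ∈ Kᶜ, δ i j := by
  have h1 : ∀ i, ∑ j, δ i j = ∑ j ∈ K, δ i j + ∑ j ∈ Kᶜ, δ i j := fun i =>
    (Finset.sum_add_sum_compl K _).symm
  have h2 : ∑ i ∈ Kᶜ, ∑ j ∈ K, δ i j = ∑ i ∈ K, ∑ j ∈ Kᶜ, δ i j := by
    rw [Finset.sum_comm]
    exact Finset.sum_congr rfl fun i _ => Finset.sum_congr rfl fun j _ => hs j i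
  rw [← Finset.sum_add_sum_compl K]
  simp only [h1, Finset.sum_add_distrib, h2]
  ring

theorem isPotential_benefit (G : SimpleGraph V) (α : ℝ) :
    IsPotential (benefit G α) (fun a => welfare G α a / 2) := by
  intro a i z
  -- The diagonal term vanishes, pairs avoiding `i` are unchanged, and the pairs containing `i`
  -- count twice, which the factor 1/2 undoes.
  have h := sum_sum_of_symm {i} (fun k j => edge G k j *
      (payoff α (Function.update a i z k) (Function.update a i z j) - payoff α (a k) (a j)))
    (fun k j => by rw [edge_symm, payoff_symm, payoff_symm α (a k)])
  have h0 : ∑ k ∈ ({i} : Finset V)ᶜ, ∑ j ∈ ({i} : Finset V)ᶜ, edge G k j *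
      (payoff α (Function.update a i z k) (Function.update a i z j) - payoff α (a k) (a j)) = 0 := by
    refine Finset.sum_eq_zero fun k hk => Finset.sum_eq_zero fun j hj => ?_
    simp only [Finset.mem_compl, Finset.mem_singleton] at hk hj
    simp [hk, hj]
  have h1 : ∑ j ∈ ({i} : Finset V)ᶜ, edge G i j *
      (payoff α (Function.update a i z i) (Function.update a i z j) - payoff α (a i) (a j)) =
      benefit G α i (Function.update a i z) - benefit G α i a := by
    rw [benefit_eq_sum, benefit_eq_sum, ← Finset.sum_sub_distrib,
      ← Finset.sum_add_sum_compl {i}, Finset.sum_singleton, edge_self]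
    simp only [mul_sub, zero_mul, sub_zero, zero_add]
  rw [h0, Finset.sum_singleton, Finset.sum_singleton, Finset.sum_singleton, h1, edge_self] at h
  simp only [mul_sub, Finset.sum_sub_distrib, ← welfare_eq_sum] at h
  dsimp only
  linarith

/-- The contribution of the imposter at `i` to the utility of agent `i`. -/
noncomputable def bonus (S : TargetSet V) (α : ℝ) (i : V) (z : Action) : ℝ :=
  (if i ∈ S.Sy ∧ z = .y then 1 else 0) + (if i ∈ S.Sx ∧ z = .x then 1 + α else 0)

/-- The potential of the game perceived under a broad attack. -/
noncomputable def broadPotential (G : SimpleGraph V) (S : TargetSet V) (α : ℝ)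
    (a : V → Action) : ℝ :=
  welfare G α a / 2 + ∑ i, bonus S α i (a i)

theorem isPotential_perceivedUtility (G : SimpleGraph V) (S : TargetSet V) (α : ℝ) :
    IsPotential (perceivedUtility G S α) (broadPotential G S α) := by
  intro a i z
  have h := isPotential_benefit G α a i z
  have hU : ∀ b, perceivedUtility G S α i b = benefit G α i b + bonus S α i (b i) := by
    intro b; unfold perceivedUtility bonus; ring
  have hsum : ∑ k, bonus S α k (Function.update a i z k) - ∑ k, bonus S α k (a k) =
      bonus S α i z - bonus S α i (a i) := by
    rw [← Finset.sum_sub_distrib, Finset.sum_eq_single i]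
    · simp
    · intro k _ hk
      simp [hk]
    · simp
  rw [hU, hU]
  unfold broadPotential
  simp only [Function.update_self]
  dsimp only at h
  linarith

theorem profiles_fullActions : (profiles (fullActions : V → Finset Action)) = Finset.univ := by
  ext a; simp [fullActions]

theorem mem_LLL_perceivedUtility_iff [Nonempty V] (G : SimpleGraph V) (S : TargetSet V) (α : ℝ)
    (a : V → Action) : a ∈ LLL fullActions (perceivedUtility G S α) ↔
      ∀ b, broadPotential G S α b ≤ broadPotential G S α a := by
  rw [mem_LLL_iff (isPotential_perceivedUtility G S α), profiles_fullActions]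
  simp

theorem mem_LLL_benefit_iff [Nonempty V] (𝒜 : V → Finset Action) (G : SimpleGraph V) (α : ℝ)
    (a : V → Action) : a ∈ LLL 𝒜 (benefit G α) ↔
      a ∈ profiles 𝒜 ∧ ∀ b ∈ profiles 𝒜, welfare G α b ≤ welfare G α a := by
  rw [mem_LLL_iff (isPotential_benefit G α)]
  refine and_congr_right fun _ => forall₂_congr fun b _ => ?_
  exact div_le_div_iff_of_pos_right two_pos

theorem LLL_subset_profiles (𝒜 : V → Finset Action) (U : V → (V → Action) → ℝ) :
    LLL 𝒜 U ⊆ profiles 𝒜 := fun _ ⟨h, _⟩ => h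

end Welfare

/-! ### Range of the risks and monotonicity of the focused risk. -/

section Risk

variable {X : Type} [Finite X] {W : X → ℝ} {L P : Set X}

theorem exists_sInf_image_eq (hL : L.Nonempty) : ∃ a ∈ L, sInf (W '' L) = W a := by
  obtain ⟨a, ha, h⟩ := (hL.image W).csInf_mem (Set.toFinite _)
  exact ⟨a, ha, h.symm⟩

theorem sInf_image_le {a : X} (ha : a ∈ L) : sInf (W '' L) ≤ W a :=
  csInf_le (Set.toFinite _).bddBelow ⟨a, ha, rfl⟩

theorem le_sSup_image {a : X} (ha : a ∈ P) : W a ≤ sSup (W '' P) :=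
  le_csSup (Set.toFinite _).bddAbove ⟨a, ha, rfl⟩

theorem one_sub_div_mem_Icc (hW : ∀ a, 0 ≤ W a) (hL : L.Nonempty) (hLP : L ⊆ P) :
    1 - sInf (W '' L) / sSup (W '' P) ∈ Set.Icc (0 : ℝ) 1 := by
  obtain ⟨a, ha, h⟩ := exists_sInf_image_eq (W := W) hL
  rw [h]
  have h1 := le_sSup_image (W := W) (hLP ha)
  have h2 := div_le_one_of_le₀ h1 ((hW a).trans h1)
  have h3 := div_nonneg (hW a) ((hW a).trans h1)
  constructor <;> linarith

end Risk

section RiskBounds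

variable {V : Type} [Fintype V] [DecidableEq V]

theorem FixedSet.profiles_nonempty (F : FixedSet V) : (profiles F.actions).Nonempty := by
  refine Fintype.piFinset_nonempty.2 fun i => ?_
  unfold FixedSet.actions
  split_ifs
  · simp
  · simp
  · exact ⟨.x, Finset.mem_univ _⟩

variable [Nonempty V]

theorem broadRisk_mem_Icc (G : SimpleGraph V) (S : TargetSet V) {αsys : ℝ} (hs : 0 ≤ αsys)
    (α : ℝ) : broadRisk G S αsys α ∈ Set.Icc (0 : ℝ) 1 :=
  one_sub_div_mem_Icc (welfare_nonneg G hs)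
    (LLL_nonempty (isPotential_perceivedUtility G S α) ⟨fun _ => .x, by simp [profiles_fullActions]⟩)
    (LLL_subset_profiles _ _)

theorem focusedRisk_mem_Icc (G : SimpleGraph V) (F : FixedSet V) {αsys : ℝ} (hs : 0 ≤ αsys)
    (α : ℝ) : focusedRisk G F αsys α ∈ Set.Icc (0 : ℝ) 1 :=
  one_sub_div_mem_Icc (welfare_nonneg G hs)
    (LLL_nonempty (isPotential_benefit G α) F.profiles_nonempty)
    (LLL_subset_profiles _ _)

/-- The risk from a focused attack grows with the gain. -/
theorem focusedRisk_mono (G : SimpleGraph V) (F : FixedSet V) {αsys α α' : ℝ} (hs : 0 ≤ αsys)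
    (h : αsys ≤ α) (h' : α ≤ α') : focusedRisk G F αsys α ≤ focusedRisk G F αsys α' := by
  rcases h'.eq_or_lt with rfl | h'
  · rfl
  obtain ⟨a, ha, hae⟩ := exists_sInf_image_eq (W := welfare G αsys)
    (LLL_nonempty (isPotential_benefit G α) F.profiles_nonempty)
  obtain ⟨b, hb⟩ := LLL_nonempty (isPotential_benefit G α') F.profiles_nonempty
  have hbe := sInf_image_le (W := welfare G αsys) hb
  rw [mem_LLL_benefit_iff] at ha hb
  have h1 := ha.2 b hb.1
  have h2 := hb.2 a ha.1
  have a1 := welfare_sub G α' α a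
  have b1 := welfare_sub G α' α b
  have a2 := welfare_sub G α αsys a
  have b2 := welfare_sub G α αsys b
  -- Adding the optimality of `a` at `α` and of `b` at `α'` gives `(α' - α) * (matchX G b - matchX G
  -- a) ≥ 0`.
  have hX : matchX G a ≤ matchX G b := by
    by_contra hlt
    nlinarith [mul_pos (sub_pos.2 h') (sub_pos.2 (not_le.1 hlt))]
  -- Passing from `α` down to `αsys` costs `b` at least as much as `a`, and `b` was no better at
  -- `α`.
  have hW : welfare G αsys b ≤ welfare G αsys a := by
    nlinarith [mul_nonneg (sub_nonneg.2 h) (sub_nonneg.2 hX)]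
  have hM := (welfare_nonneg G hs a).trans (le_sSup_image (W := welfare G αsys)
    (P := (profiles F.actions : Set (V → Action))) ha.1)
  unfold focusedRisk focusedEfficiency
  have := div_le_div_of_nonneg_right ((hbe.trans hW).trans hae.ge) hM
  linarith

end RiskBounds

end CoordGame

namespace CoordGame

/-! ### Components of a set of vertices. -/

section Components

variable {V : Type}

/-- Averaging over connected components: if a vertex function has non-positive sum over `Y`, so it
has over some component of the graph induced on `Y`. -/
theorem exists_component_sum_nonpos (G : SimpleGraph V) {Y : Finset V} (hY : Y.Nonempty)
    (g : V → ℝ) (hg : ∑ i ∈ Y, g i ≤ 0) :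
    ∃ K ⊆ Y, (∀ i ∈ K, ∀ j ∈ Y, G.Adj i j → j ∈ K) ∧ (G.induce (K : Set V)).Connected ∧
      ∑ i ∈ K, g i ≤ 0 := by
  classical
  -- Vertices outside `Y` are isolated in `H`, so a component of `H` meeting `Y` lies in `Y`.
  let H : SimpleGraph V :=
    { Adj := fun i j => G.Adj i j ∧ i ∈ Y ∧ j ∈ Y
      symm := ⟨fun _ _ h => ⟨h.1.symm, h.2.2, h.2.1⟩⟩
      loopless := ⟨fun _ h => G.irrefl h.1⟩ }
  have hle : H ≤ G := fun _ _ h => h.1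
  have hsum := Finset.sum_fiberwise_of_maps_to (s := Y) (t := Y.image H.connectedComponentMk)
    (g := H.connectedComponentMk) (fun i hi => Finset.mem_image_of_mem _ hi) g
  obtain ⟨C, hC, hC0⟩ := Finset.exists_le_of_sum_le (s := Y.image H.connectedComponentMk)
    (f := fun C => ∑ i ∈ Y with H.connectedComponentMk i = C, g i) (g := fun _ => 0)
    (hY.image _) (by rw [hsum]; simpa using hg)
  obtain ⟨v, hv, rfl⟩ := Finset.mem_image.1 hC
  have hset : ((Y.filter fun i => H.connectedComponentMk i = H.connectedComponentMk v :
      Finset V) : Set V) = (H.connectedComponentMk v).supp := by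
    ext i
    simp only [Finset.coe_filter, Set.mem_ofPred_eq, SimpleGraph.ConnectedComponent.mem_supp_iff,
      and_iff_right_iff_imp]
    intro h
    obtain ⟨w⟩ := SimpleGraph.ConnectedComponent.eq.1 h
    cases w with
    | nil => exact hv
    | cons h _ => exact h.2.1
  refine ⟨Y.filter fun i => H.connectedComponentMk i = H.connectedComponentMk v,
    Finset.filter_subset _ _, ?_, ?_, hC0⟩
  · intro i hi j hj hij
    rw [Finset.mem_filter] at hi ⊢
    refine ⟨hj, ?_⟩
    rw [← hi.2]
    have : H.Adj j i := ⟨hij.symm, hj, hi.1⟩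
    exact SimpleGraph.ConnectedComponent.eq.2 this.reachable
  · rw [hset]
    exact (H.connectedComponentMk v).connected_toSimpleGraph.mono
      (SimpleGraph.comap_monotone _ hle)

end Components

/-! ### Pendant graphs and stability of a block of `y`-players. -/

section Pendant

variable {V : Type} [Fintype V] [DecidableEq V]

open Classical in
/-- The edges of `G` leaving `K`, oriented outwards. -/
noncomputable def outEdges (G : SimpleGraph V) (K : Finset V) : Finset (K × V) :=
  Finset.univ.filter fun p => G.Adj p.1 p.2 ∧ p.2 ∉ K

theorem mem_outEdges {G : SimpleGraph V} {K : Finset V} {p : K × V} :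
    p ∈ outEdges G K ↔ G.Adj p.1 p.2 ∧ p.2 ∉ K := by
  simp [outEdges]

/-- The graph induced on `K`, in which every edge leaving `K` is kept as a pendant edge. -/
def pendantGraph (G : SimpleGraph V) (K : Finset V) : SimpleGraph (K ⊕ outEdges G K) where
  Adj
    | .inl i, .inl j => G.Adj i j
    | .inl i, .inr l => l.1.1 = i
    | .inr l, .inl i => l.1.1 = i
    | .inr _, .inr _ => False
  symm := ⟨by rintro (i | l) (j | m) h <;> first | exact h.symm | exact h⟩
  loopless := ⟨by rintro (i | l) h <;> first | exact G.irrefl h | exact h⟩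

variable (G : SimpleGraph V) (K : Finset V)

theorem sum_outEdges (f : K → ℝ) :
    ∑ l : outEdges G K, f l.1.1 = ∑ i : K, f i * ∑ j ∈ Kᶜ, edge G i j := by
  rw [Finset.sum_coe_sort (outEdges G K) (fun p => f p.1)]
  unfold outEdges
  rw [Finset.sum_filter, Fintype.sum_prod_type]
  refine Finset.sum_congr rfl fun i _ => ?_
  rw [Finset.mul_sum, ← Finset.sum_add_sum_compl K, Finset.sum_eq_zero, zero_add]
  · refine Finset.sum_congr rfl fun j hj => ?_
    rw [Finset.mem_compl] at hj
    by_cases h : G.Adj i j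
    · simp [h, hj, edge_of_adj h]
    · simp [h, edge_of_not_adj h]
  · intro j hj
    simp [hj]

theorem welfare_pendantGraph (α : ℝ) (b : K ⊕ outEdges G K → Action) :
    welfare (pendantGraph G K) α b =
      ∑ i : K, ∑ j : K, edge G i j * payoff α (b (.inl i)) (b (.inl j)) +
      2 * ∑ l : outEdges G K, payoff α (b (.inl l.1.1)) (b (.inr l)) := by
  have e1 : ∀ i j : K, edge (pendantGraph G K) (.inl i) (.inl j) = edge G i j := by
    intro i j
    by_cases h : G.Adj i j
    · rw [edge_of_adj h, edge_of_adj]; exact h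
    · rw [edge_of_not_adj h, edge_of_not_adj]; exact h
  have e2 : ∀ (i : K) (l : outEdges G K),
      edge (pendantGraph G K) (.inl i) (.inr l) = if l.1.1 = i then 1 else 0 := by
    intro i l
    split_ifs with h
    · exact edge_of_adj h
    · exact edge_of_not_adj h
  have e3 : ∀ l m : outEdges G K, edge (pendantGraph G K) (.inr l) (.inr m) = 0 := fun l m =>
    edge_of_not_adj fun h => h
  rw [welfare_eq_sum]
  simp only [Fintype.sum_sum_type, e1, e2, e3, edge_symm _ (Sum.inr _) (Sum.inl _),
    payoff_symm α (b (Sum.inr _)) (b (Sum.inl _)), zero_mul, Finset.sum_const_zero, add_zero,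
    Finset.sum_add_distrib]
  rw [Finset.sum_comm (s := (Finset.univ : Finset K)) (t := (Finset.univ : Finset (outEdges G K)))]
  simp only [ite_mul, one_mul, zero_mul, Finset.sum_ite_eq, Finset.mem_univ, if_true]
  ring

theorem connected_pendantGraph (hK : (G.induce (K : Set V)).Connected) :
    (pendantGraph G K).Connected := by
  have hne : Nonempty K := hK.nonempty
  let φ : G.induce (K : Set V) →g pendantGraph G K :=
    { toFun := fun i => .inl i
      map_rel' := fun h => h }
  have h1 : ∀ i j : K, (pendantGraph G K).Reachable (.inl i) (.inl j) := fun i j =>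
    (hK.preconnected i j).map φ
  have h2 : ∀ v, ∃ i : K, (pendantGraph G K).Reachable v (.inl i) := by
    rintro (i | l)
    · exact ⟨i, .refl _⟩
    · refine ⟨l.1.1, SimpleGraph.Adj.reachable ?_⟩
      exact (rfl : l.1.1 = l.1.1)
  have : Nonempty (K ⊕ outEdges G K) := hne.map .inl
  refine ⟨fun u v => ?_⟩
  obtain ⟨i, hi⟩ := h2 u
  obtain ⟨j, hj⟩ := h2 v
  exact hi.trans ((h1 i j).trans hj.symm)

/-- `y`-imposters on `K`, `x`-imposters on the pendant vertices. -/
noncomputable def pendantTarget : TargetSet (K ⊕ outEdges G K) where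
  Sx := Finset.univ.filter fun v => v.isRight
  Sy := Finset.univ.filter fun v => v.isLeft
  disjoint := by
    rw [Finset.disjoint_filter]
    rintro (i | l) <;> simp
  cover := by
    ext v
    cases v <;> simp

/-- Everybody on `K` plays `y`, the pendant vertices play `x`. -/
def pendantProfile : K ⊕ outEdges G K → Action := Sum.elim (fun _ => .y) (fun _ => .x)

theorem broadPotential_pendantGraph (α : ℝ) (b : K ⊕ outEdges G K → Action) :
    broadPotential (pendantGraph G K) (pendantTarget G K) α b =
      (∑ i : K, ∑ j : K, edge G i j * payoff α (b (.inl i)) (b (.inl j))) / 2 +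
      ∑ i : K, (if b (.inl i) = .y then 1 else 0) +
      ∑ l : outEdges G K, (payoff α (b (.inl l.1.1)) (b (.inr l)) +
        if b (.inr l) = .x then 1 + α else 0) := by
  unfold broadPotential
  rw [welfare_pendantGraph, Fintype.sum_sum_type, Finset.sum_add_distrib]
  simp only [bonus, pendantTarget, Finset.mem_filter, Finset.mem_univ, true_and, Sum.isLeft_inl,
    Sum.isRight_inl, Sum.isLeft_inr, Sum.isRight_inr, Bool.false_eq_true, false_and, if_false,
    add_zero, zero_add]
  ring

/-- No subset of `K` gains from switching from `y` to `x` when every agent of `K` has a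
`y`-imposter, and all neighbours outside `K` play `x`. -/
def IsStable (α : ℝ) : Prop :=
  ∀ c : K → Action, (∑ i : K, ∑ j : K, edge G i j * payoff α (c i) (c j)) / 2 +
    ∑ i, (if c i = .y then 1 else 0) +
    (1 + α) * ∑ i, (if c i = .x then 1 else 0) * ∑ j ∈ Kᶜ, edge G i j ≤
    (∑ i : K, ∑ j : K, edge G i j) / 2 + K.card

variable {G K}

theorem sum_boundary_nonneg (c : K → Action) :
    0 ≤ ∑ i, (if c i = .x then 1 else 0) * ∑ j ∈ Kᶜ, edge G i j :=
  Finset.sum_nonneg fun i _ => mul_nonneg (by split_ifs <;> norm_num)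
    (Finset.sum_nonneg fun j _ => edge_nonneg _ _ _)

/-- The gain occurs only on the left, where it multiplies nonnegative edge counts. This is why one
attack serves all smaller gains. -/
theorem IsStable.anti {α α' : ℝ} (h : IsStable G K α) (hα : α' ≤ α) : IsStable G K α' := by
  intro c
  refine le_trans ?_ (h c)
  have h1 : ∑ i : K, ∑ j : K, edge G i j * payoff α' (c i) (c j) ≤
      ∑ i : K, ∑ j : K, edge G i j * payoff α (c i) (c j) := by
    refine Finset.sum_le_sum fun i _ => Finset.sum_le_sum fun j _ =>
      mul_le_mul_of_nonneg_left ?_ (edge_nonneg _ _ _)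
    cases c i <;> cases c j <;> simp [payoff, hα]
  have h2 := mul_le_mul_of_nonneg_right (add_le_add_right hα 1) (sum_boundary_nonneg (G := G)
    (K := K) c)
  linarith

/-- Testing stability against all of `K` playing `x` gives `(1 + α) * #outEdges ≤ #K`. The strict
inequality later guarantees three nodes. -/
theorem IsStable.card_outEdges_lt {α : ℝ} (hα : 0 < α) (h : IsStable G K α)
    (hne : (outEdges G K).Nonempty) : (outEdges G K).card < K.card := by
  have h1 := h fun _ => .x
  have h2 := sum_outEdges G K fun _ => 1
  have h3 : (0 : ℝ) ≤ ∑ i : K, ∑ j : K, edge G i j :=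
    Finset.sum_nonneg fun i _ => Finset.sum_nonneg fun j _ => edge_nonneg _ _ _
  have h4 : (0 : ℝ) < (outEdges G K).card := by exact_mod_cast hne.card_pos
  simp only [payoff, if_true, reduceCtorEq, if_false, one_mul, Finset.sum_const_zero, add_zero,
    ← Finset.sum_mul] at h1
  simp only [one_mul, Finset.sum_const, Finset.card_univ, Fintype.card_coe, nsmul_eq_mul,
    mul_one] at h2
  rw [← h2] at h1
  have : ((outEdges G K).card : ℝ) < K.card := by nlinarith
  exact_mod_cast this

/-- A leaf with its imposter contributes at most `2 * (1 + α)` if its neighbour plays `x` and at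
most `1 + α` otherwise; what then remains is stability of `K`. -/
theorem IsStable.pendantProfile_isMax {α : ℝ} (hα : 0 ≤ α) (h : IsStable G K α)
    (b : K ⊕ outEdges G K → Action) :
    broadPotential (pendantGraph G K) (pendantTarget G K) α b ≤
      broadPotential (pendantGraph G K) (pendantTarget G K) α (pendantProfile G K) := by
  rw [broadPotential_pendantGraph, broadPotential_pendantGraph]
  have h1 := h fun i => b (.inl i)
  rw [← sum_outEdges G K fun i => if b (.inl i) = .x then 1 else 0, Finset.mul_sum] at h1
  have h2 : ∑ l : outEdges G K, (payoff α (b (.inl l.1.1)) (b (.inr l)) +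
      if b (.inr l) = .x then 1 + α else 0) ≤
      ∑ l : outEdges G K, (1 + α) * (if b (.inl l.1.1) = .x then 1 else 0) +
        ∑ _l : outEdges G K, (1 + α) := by
    rw [← Finset.sum_add_distrib]
    refine Finset.sum_le_sum fun l _ => ?_
    cases b (.inl l.1.1) <;> cases b (.inr l) <;> simp [payoff] <;> linarith
  have p1 : payoff α .y .y = 1 := rfl
  have p2 : payoff α .y .x = 0 := rfl
  simp only [pendantProfile, Sum.elim_inl, Sum.elim_inr, p1, p2, if_true, mul_one, zero_add,
    Finset.sum_const (1 : ℝ), Finset.card_univ, Fintype.card_coe, nsmul_eq_mul]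
  linarith

/-- A set of `y`-players whose outside neighbours all play `x` in a state of maximal potential is
stable. -/
theorem isStable_of_isMax {S : TargetSet V} {α : ℝ} (hα : 0 ≤ α) {a : V → Action}
    (ha : ∀ b, broadPotential G S α b ≤ broadPotential G S α a) (hy : ∀ i ∈ K, a i = .y)
    (hx : ∀ i ∈ K, ∀ j ∉ K, G.Adj i j → a j = .x) : IsStable G K α := by
  intro c
  set b : V → Action := fun i => if h : i ∈ K then c ⟨i, h⟩ else a i with hb
  have hbK : ∀ i : K, b i = c i := fun i => by simp [hb]
  have hbn : ∀ i ∉ K, b i = a i := fun i hi => by simp [hb, hi]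
  have h := ha b
  have hs := sum_sum_of_symm K
    (fun i j => edge G i j * (payoff α (b i) (b j) - payoff α (a i) (a j)))
    (fun i j => by rw [edge_symm, payoff_symm, payoff_symm α (a i)])
  have h0 : ∑ i ∈ Kᶜ, ∑ j ∈ Kᶜ,
      edge G i j * (payoff α (b i) (b j) - payoff α (a i) (a j)) = 0 := by
    refine Finset.sum_eq_zero fun i hi => Finset.sum_eq_zero fun j hj => ?_
    rw [Finset.mem_compl] at hi hj
    rw [hbn i hi, hbn j hj, sub_self, mul_zero]
  have h1 : ∑ i ∈ K, ∑ j ∈ Kᶜ, edge G i j * (payoff α (b i) (b j) - payoff α (a i) (a j)) =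
      (1 + α) * ∑ i : K, (if c i = .x then 1 else 0) * ∑ j ∈ Kᶜ, edge G i j := by
    rw [← Finset.sum_coe_sort K, Finset.mul_sum]
    refine Finset.sum_congr rfl fun i _ => ?_
    rw [Finset.mul_sum, Finset.mul_sum]
    refine Finset.sum_congr rfl fun j hj => ?_
    rw [Finset.mem_compl] at hj
    rw [hbK i, hbn j hj, hy i i.2]
    by_cases hij : G.Adj i j
    · rw [hx i i.2 j hj hij, edge_of_adj hij]
      cases c i <;> simp [payoff]
    · rw [edge_of_not_adj hij]
      simp
  have h2 : ∑ i ∈ K, ∑ j ∈ K, edge G i j * (payoff α (b i) (b j) - payoff α (a i) (a j)) =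
      ∑ i : K, ∑ j : K, edge G i j * payoff α (c i) (c j) - ∑ i : K, ∑ j : K, edge G i j := by
    rw [← Finset.sum_coe_sort K, ← Finset.sum_sub_distrib]
    refine Finset.sum_congr rfl fun i _ => ?_
    rw [← Finset.sum_coe_sort K, ← Finset.sum_sub_distrib]
    refine Finset.sum_congr rfl fun j _ => ?_
    rw [hbK, hbK, hy i i.2, hy j j.2]
    simp [payoff, mul_sub]
  -- Switching from `y` to `x` changes the bonus by `-1` or `1 + α`, so `y`-imposters throughout `K`
  -- are the case hardest to leave, whatever `S` is.
  have h3 : ∑ i : K, (if c i = .y then (1 : ℝ) else 0) - K.card ≤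
      ∑ i, bonus S α i (b i) - ∑ i, bonus S α i (a i) := by
    rw [← Finset.sum_sub_distrib, ← Finset.sum_add_sum_compl K, Finset.sum_eq_zero (s := Kᶜ),
      add_zero, ← Finset.sum_coe_sort K, ← Fintype.card_coe, Fintype.card_eq_sum_ones,
      Nat.cast_sum, ← Finset.sum_sub_distrib]
    · refine Finset.sum_le_sum fun i _ => ?_
      rw [hbK, hy i i.2]
      cases c i <;> simp [bonus]
      split_ifs <;> linarith
    · intro i hi
      rw [Finset.mem_compl] at hi
      rw [hbn i hi, sub_self]
  rw [h0, h1, h2] at hs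
  simp only [mul_sub, Finset.sum_sub_distrib, ← welfare_eq_sum] at hs
  unfold broadPotential at h
  linarith

end Pendant

end CoordGame

namespace CoordGame

/-! ### Relabelling nodes, since the worst cases range over graphs on `Fin N`. -/

section Transport

variable {V V' : Type} [Fintype V] [Fintype V']

theorem welfare_comap (G : SimpleGraph V) (e : V' ≃ V) (α : ℝ) (a : V → Action) :
    welfare (G.comap e) α (a ∘ e) = welfare G α a := by
  have he : ∀ i j, edge (G.comap e) i j = edge G (e i) (e j) := fun i j => rfl
  simp only [welfare_eq_sum, he, Function.comp_apply]
  rw [← Equiv.sum_comp e]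
  exact Finset.sum_congr rfl fun i _ =>
    Equiv.sum_comp e fun j => edge G (e i) j * payoff α (a (e i)) (a j)

theorem welfare_const_x_pos [Nontrivial V] {G : SimpleGraph V} (hG : G.Connected) {α : ℝ} (hα : 0 ≤ α) :
    0 < welfare G α fun _ => .x := by
  obtain ⟨i⟩ := hG.nonempty
  obtain ⟨j, hj⟩ := hG.preconnected.exists_adj_of_nontrivial i
  rw [welfare_const_x]
  have h1 : edge G i j ≤ ∑ j, edge G i j :=
    Finset.single_le_sum (fun j _ => edge_nonneg G i j) (Finset.mem_univ j)
  have h2 : ∑ j, edge G i j ≤ ∑ i, ∑ j, edge G i j :=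
    Finset.single_le_sum (f := fun i => ∑ j, edge G i j)
      (fun i _ => Finset.sum_nonneg fun j _ => edge_nonneg G i j) (Finset.mem_univ i)
  rw [edge_of_adj hj] at h1
  exact mul_pos (by linarith) (by linarith)

variable [DecidableEq V] [DecidableEq V']

/-- A target set carried over along a bijection of the nodes. -/
def TargetSet.comap (S : TargetSet V) (e : V' ≃ V) : TargetSet V' where
  Sx := Finset.univ.filter fun i => e i ∈ S.Sx
  Sy := Finset.univ.filter fun i => e i ∈ S.Sy
  disjoint := by
    rw [Finset.disjoint_filter]
    exact fun i _ h h' => Finset.disjoint_left.1 S.disjoint h h'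
  cover := by
    ext i
    have : e i ∈ S.Sx ∪ S.Sy := S.cover ▸ Finset.mem_univ _
    simpa using this

theorem broadPotential_comap (G : SimpleGraph V) (S : TargetSet V) (e : V' ≃ V) (α : ℝ)
    (a : V → Action) :
    broadPotential (G.comap e) (S.comap e) α (a ∘ e) = broadPotential G S α a := by
  unfold broadPotential
  rw [welfare_comap, ← Equiv.sum_comp e]
  simp [bonus, TargetSet.comap]

theorem sSup_welfare_fullActions (G : SimpleGraph V) {α : ℝ} (hα : 0 ≤ α) :
    sSup (welfare G α '' (profiles (fullActions : V → Finset Action) : Set (V → Action))) =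
      welfare G α fun _ => .x := by
  refine le_antisymm (csSup_le ⟨_, fun _ => .x, by simp [profiles_fullActions], rfl⟩ ?_)
    (le_sSup_image (by simp [profiles_fullActions]))
  rintro _ ⟨a, -, rfl⟩
  exact welfare_le_const_x G hα a

/-- A maximizer of the potential bounds the broad risk from below. -/
theorem le_broadRisk [Nonempty V] (G : SimpleGraph V) (S : TargetSet V) {αsys α : ℝ}
    (hs : 0 ≤ αsys) {a : V → Action}
    (ha : ∀ b, broadPotential G S α b ≤ broadPotential G S α a) :
    1 - welfare G αsys a / welfare G αsys (fun _ => .x) ≤ broadRisk G S αsys α := by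
  unfold broadRisk broadEfficiency
  rw [sSup_welfare_fullActions G hs]
  have h := sInf_image_le (W := welfare G αsys) ((mem_LLL_perceivedUtility_iff G S α a).2 ha)
  have := div_le_div_of_nonneg_right h (welfare_nonneg G hs fun _ => .x)
  linarith

theorem exists_broadRisk_eq [Nonempty V] (G : SimpleGraph V) (S : TargetSet V) {αsys : ℝ}
    (hs : 0 ≤ αsys) (α : ℝ) : ∃ a, (∀ b, broadPotential G S α b ≤ broadPotential G S α a) ∧
      broadRisk G S αsys α = 1 - welfare G αsys a / welfare G αsys fun _ => .x := by
  obtain ⟨a, ha, h⟩ := exists_sInf_image_eq (W := welfare G αsys)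
    (LLL_nonempty (𝒜 := fullActions) (isPotential_perceivedUtility G S α)
      ⟨fun _ => .x, by simp [profiles_fullActions]⟩)
  refine ⟨a, (mem_LLL_perceivedUtility_iff G S α a).1 ha, ?_⟩
  unfold broadRisk broadEfficiency
  rw [sSup_welfare_fullActions G hs, h]

end Transport

/-! ### Transferring a broad attack to smaller gains. -/

section Construction

variable {V : Type} [Fintype V] [DecidableEq V] {G : SimpleGraph V} {K : Finset V}

theorem welfare_pendantProfile (α : ℝ) : welfare (pendantGraph G K) α (pendantProfile G K) =
    ∑ i ∈ K, ∑ j ∈ K, edge G i j := by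
  have p1 : payoff α .y .y = 1 := rfl
  have p2 : payoff α .y .x = 0 := rfl
  rw [welfare_pendantGraph, ← Finset.sum_coe_sort K]
  simp only [pendantProfile, Sum.elim_inl, Sum.elim_inr, p1, p2, mul_one, Finset.sum_const_zero,
    mul_zero, add_zero]
  exact Finset.sum_congr rfl fun i _ => Finset.sum_coe_sort K fun j => edge G i j

theorem welfare_pendantGraph_const_x (α : ℝ) : welfare (pendantGraph G K) α (fun _ => .x) =
    (1 + α) * (∑ i ∈ K, ∑ j ∈ K, edge G i j + 2 * ∑ i ∈ K, ∑ j ∈ Kᶜ, edge G i j) := by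
  have p1 : payoff α .x .x = 1 + α := rfl
  rw [welfare_pendantGraph, ← Finset.sum_coe_sort K, ← Finset.sum_coe_sort K,
    sum_outEdges G K fun _ => payoff α .x .x]
  simp only [p1, ← Finset.sum_mul, ← Finset.mul_sum]
  simp only [Finset.sum_coe_sort K]
  ring

/-- In a connected graph a non-empty proper subset has an outgoing edge. -/
theorem outEdges_nonempty (hG : G.Connected) (hK : K.Nonempty) (hne : K ≠ Finset.univ) :
    (outEdges G K).Nonempty := by
  obtain ⟨u, hu⟩ := hK
  obtain ⟨v, hv⟩ : ∃ v, v ∉ K := by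
    by_contra! h
    exact hne (Finset.eq_univ_of_forall h)
  obtain ⟨w⟩ := hG.preconnected u v
  obtain ⟨d, -, h1, h2⟩ := w.exists_boundary_dart (K : Set V) hu hv
  exact ⟨(⟨d.fst, h1⟩, d.snd), mem_outEdges.2 ⟨d.adj, h2⟩⟩

/-- Among the components of the `y`-players there is one whose pendant graph is at most as efficient
as the whole. -/
theorem exists_inefficient_component {αsys : ℝ} (hs : 0 ≤ αsys) {a : V → Action}
    (hy : ∃ i, a i = .y) : ∃ K : Finset V, (∀ i ∈ K, a i = .y) ∧
      (∀ i ∈ K, ∀ j ∉ K, G.Adj i j → a j = .x) ∧ (G.induce (K : Set V)).Connected ∧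
      welfare (pendantGraph G K) αsys (pendantProfile G K) ≤
        welfare G αsys a / welfare G αsys (fun _ => .x) *
          welfare (pendantGraph G K) αsys (fun _ => .x) := by
  set ρ := welfare G αsys a / welfare G αsys (fun _ => .x) with hρ
  set Y : Finset V := Finset.univ.filter fun i => a i = .y with hY
  have mY : ∀ i, i ∈ Y ↔ a i = .y := fun i => by simp [hY]
  have mYc : ∀ i, i ∈ Yᶜ ↔ a i = .x := fun i => by
    rw [Finset.mem_compl, mY]; cases a i <;> simp
  have hρ1 : ρ ≤ 1 := div_le_one_of_le₀ (welfare_le_const_x G hs a) (welfare_nonneg G hs _)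
  -- If the denominator is 0, the smaller welfare of `a` vanishes too.
  have hρW : ρ * welfare G αsys (fun _ => .x) = welfare G αsys a := by
    refine div_mul_cancel_of_imp fun h => ?_
    exact le_antisymm (h ▸ welfare_le_const_x G hs a) (welfare_nonneg G hs a)
  have hx := welfare_const_x G αsys
  rw [sum_sum_of_symm Y _ (edge_symm G)] at hx
  have ha := welfare_eq_sum G αsys a
  rw [sum_sum_of_symm Y _ (fun i j => by rw [edge_symm, payoff_symm])] at ha
  have h1 : ∑ i ∈ Y, ∑ j ∈ Y, edge G i j * payoff αsys (a i) (a j) =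
      ∑ i ∈ Y, ∑ j ∈ Y, edge G i j := by
    refine Finset.sum_congr rfl fun i hi => Finset.sum_congr rfl fun j hj => ?_
    rw [(mY i).1 hi, (mY j).1 hj]
    simp [payoff]
  have h2 : ∑ i ∈ Y, ∑ j ∈ Yᶜ, edge G i j * payoff αsys (a i) (a j) = 0 := by
    refine Finset.sum_eq_zero fun i hi => Finset.sum_eq_zero fun j hj => ?_
    rw [(mY i).1 hi, (mYc j).1 hj]
    simp [payoff]
  have h3 : ∑ i ∈ Yᶜ, ∑ j ∈ Yᶜ, edge G i j * payoff αsys (a i) (a j) =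
      (1 + αsys) * ∑ i ∈ Yᶜ, ∑ j ∈ Yᶜ, edge G i j := by
    simp only [Finset.mul_sum]
    refine Finset.sum_congr rfl fun i hi => Finset.sum_congr rfl fun j hj => ?_
    rw [(mYc i).1 hi, (mYc j).1 hj]
    simp [payoff, mul_comm]
  have h4 : 0 ≤ ∑ i ∈ Yᶜ, ∑ j ∈ Yᶜ, edge G i j :=
    Finset.sum_nonneg fun i _ => Finset.sum_nonneg fun j _ => edge_nonneg _ _ _
  rw [h1, h2, h3] at ha
  -- Summed over a component, these weights give the pendant profile's welfare minus `ρ` times the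
  -- all-`x` welfare. Over `Y` the sum is nonpositive: it drops only the `x`-`x` edges, whose
  -- efficiency is 1, at least `ρ`.
  obtain ⟨K, hKY, hcl, hconn, hK⟩ := exists_component_sum_nonpos G
    (Y := Y) (hy.imp fun i hi => (mY i).2 hi)
    (fun i => ∑ j ∈ Y, edge G i j - ρ * (1 + αsys) * (∑ j ∈ Y, edge G i j +
      2 * ∑ j ∈ Yᶜ, edge G i j)) (by
      simp only [Finset.sum_sub_distrib, ← Finset.mul_sum, Finset.sum_add_distrib]
      have h5 := mul_nonneg (mul_nonneg (sub_nonneg.2 hρ1) (by linarith : 0 ≤ 1 + αsys)) h4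
      rw [ha, hx] at hρW
      linarith)
  have hx' : ∀ i ∈ K, ∀ j ∉ K, G.Adj i j → a j = .x := fun i hi j hj hij =>
    (mYc j).1 (Finset.mem_compl.2 fun h => hj (hcl i hi j h hij))
  refine ⟨K, fun i hi => (mY i).1 (hKY hi), hx', hconn, ?_⟩
  rw [welfare_pendantProfile, welfare_pendantGraph_const_x]
  have e1 : ∀ i ∈ K, ∑ j ∈ Y, edge G i j = ∑ j ∈ K, edge G i j := by
    intro i hi
    refine (Finset.sum_subset hKY fun j hj hjK => edge_of_not_adj fun h => hjK ?_).symm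
    exact hcl i hi j hj h
  have e2 : ∀ i ∈ K, ∑ j ∈ Yᶜ, edge G i j = ∑ j ∈ Kᶜ, edge G i j := by
    intro i hi
    refine Finset.sum_subset (Finset.compl_subset_compl.2 hKY) fun j hj hjY =>
      edge_of_not_adj fun h => hjY ?_
    exact (mYc j).2 (hx' i hi j (Finset.mem_compl.1 hj) h)
  rw [Finset.sum_congr rfl fun i hi => by rw [e1 i hi, e2 i hi]] at hK
  simp only [Finset.sum_sub_distrib, ← Finset.mul_sum, Finset.sum_add_distrib] at hK
  linarith

/-- The risk of a broad attack against the gain `α` is attained, on a possibly different graph, by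
an attack that does at least as much harm to every smaller gain. -/
theorem exists_broadRisk_le {N : ℕ} (hN : 3 ≤ N) {G : SimpleGraph (Fin N)} (hG : G.Connected)
    (S : TargetSet (Fin N)) {αsys α : ℝ} (hs : 0 ≤ αsys) (hα : 0 < α) :
    ∃ N' : ℕ, 3 ≤ N' ∧ ∃ G' : SimpleGraph (Fin N'), G'.Connected ∧ ∃ S' : TargetSet (Fin N'),
      ∀ α', 0 ≤ α' → α' ≤ α → broadRisk G S αsys α ≤ broadRisk G' S' αsys α' := by
  have : Nonempty (Fin N) := hG.nonempty
  obtain ⟨a, hmax, hrisk⟩ := exists_broadRisk_eq G S hs α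
  by_cases hy : ∃ i, a i = .y
  · obtain ⟨K, hKy, hKx, hconn, hle⟩ := exists_inefficient_component (G := G) hs hy
    have hst := isStable_of_isMax hα.le hmax hKy hKx
    have hKne : K.Nonempty := by
      obtain ⟨i⟩ := hconn.nonempty
      exact ⟨i, i.2⟩
    -- Either `K` is everything, or there is at least one leaf and strictly more vertices in `K`
    -- than leaves.
    have hcard : 3 ≤ Fintype.card (K ⊕ outEdges G K) := by
      rw [Fintype.card_sum, Fintype.card_coe, Fintype.card_coe]
      by_cases hu : K = Finset.univ
      · rw [hu, Finset.card_univ, Fintype.card_fin]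
        omega
      · have h1 := outEdges_nonempty hG hKne hu
        have h2 := hst.card_outEdges_lt hα h1
        have h3 := h1.card_pos
        omega
    have hne : Nonempty (K ⊕ outEdges G K) := Fintype.card_pos_iff.1 (by omega)
    let e := (Fintype.equivFin (K ⊕ outEdges G K)).symm
    have hne' : Nonempty (Fin (Fintype.card (K ⊕ outEdges G K))) := ⟨e.symm hne.some⟩
    refine ⟨_, hcard, (pendantGraph G K).comap e,
      (SimpleGraph.Iso.comap e _).connected_iff.2 (connected_pendantGraph G K hconn),
      (pendantTarget G K).comap e, fun α' h0 hα' => ?_⟩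
    have h := le_broadRisk (αsys := αsys) (α := α') ((pendantGraph G K).comap e)
      ((pendantTarget G K).comap e) hs (a := pendantProfile G K ∘ e) (fun b => by
        have hb : b = (b ∘ e.symm) ∘ e := by ext i; simp
        rw [hb, broadPotential_comap, broadPotential_comap]
        exact (hst.anti hα').pendantProfile_isMax h0 _)
    refine le_trans ?_ h
    have hc : (fun _ : Fin (Fintype.card (K ⊕ outEdges G K)) => Action.x) =
        (fun _ : K ⊕ outEdges G K => Action.x) ∘ e := rfl
    rw [hrisk, hc, welfare_comap, welfare_comap]
    have := div_le_of_le_mul₀ (welfare_nonneg (pendantGraph G K) hs fun _ => .x)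
      (div_nonneg (welfare_nonneg G hs a) (welfare_nonneg G hs fun _ => .x)) hle
    linarith
  -- Without `y`-players the risk is 0, and the given attack itself will do.
  · refine ⟨N, hN, G, hG, S, fun α' _ _ => le_trans ?_ (broadRisk_mem_Icc G S hs α').1⟩
    have ha : a = fun _ => .x := by
      funext i
      cases h : a i
      · rfl
      · exact absurd ⟨i, h⟩ hy
    have : Nontrivial (Fin N) := Fin.nontrivial_iff_two_le.2 (by omega)
    have hx := welfare_const_x_pos hG hs
    rw [hrisk, ha, div_self hx.ne', sub_self]

end Construction

end CoordGame

namespace CoordGame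

/-! ### The two families of inequalities for worst-case expected risks. -/

section Worst

/-- Nonnegativity of `E` covers both `c = 0` and empty `S`, where `sSup` is 0. -/
theorem mul_sSup_le {S : Set ℝ} {c E : ℝ} (hc : 0 ≤ c) (hE : 0 ≤ E) (h : ∀ r ∈ S, c * r ≤ E) :
    c * sSup S ≤ E := by
  rcases hc.eq_or_lt with rfl | hc
  · simpa using hE
  · rw [← le_div_iff₀' hc]
    exact Real.sSup_le (fun r hr => (le_div_iff₀' hc).2 (h r hr)) (div_nonneg hE hc.le)

theorem sSup_mem_Icc {S : Set ℝ} (h : ∀ r ∈ S, r ∈ Set.Icc (0 : ℝ) 1) :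
    sSup S ∈ Set.Icc (0 : ℝ) 1 :=
  ⟨Real.sSup_nonneg fun r hr => (h r hr).1, Real.sSup_le (fun r hr => (h r hr).2) zero_le_one⟩

variable {αsys : ℝ}

theorem broadRisk_mem_Icc_of_connected (hs : 0 ≤ αsys) {N : ℕ} {G : SimpleGraph (Fin N)}
    (hG : G.Connected) (S : TargetSet (Fin N)) (α : ℝ) :
    broadRisk G S αsys α ∈ Set.Icc (0 : ℝ) 1 :=
  have := hG.nonempty
  broadRisk_mem_Icc G S hs α

theorem focusedRisk_mem_Icc_of_connected (hs : 0 ≤ αsys) {N : ℕ} {G : SimpleGraph (Fin N)}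
    (hG : G.Connected) (F : FixedSet (Fin N)) (α : ℝ) :
    focusedRisk G F αsys α ∈ Set.Icc (0 : ℝ) 1 :=
  have := hG.nonempty
  focusedRisk_mem_Icc G F hs α

theorem worstBroad_mem_Icc (hs : 0 ≤ αsys) (α : ℝ) : worstBroad αsys α ∈ Set.Icc (0 : ℝ) 1 :=
  sSup_mem_Icc (by
    rintro _ ⟨N, -, G, hG, S, rfl⟩
    exact broadRisk_mem_Icc_of_connected hs hG S α)

theorem worstFocused_nonneg (hs : 0 ≤ αsys) (α : ℝ) : 0 ≤ worstFocused αsys α :=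
  (sSup_mem_Icc (by
    rintro _ ⟨N, -, G, hG, F, rfl⟩
    exact focusedRisk_mem_Icc_of_connected hs hG F α)).1

variable {M : ℕ} {α p : Fin M → ℝ}

theorem expected_mem_Icc (hp : p ∈ stdSimplex ℝ (Fin M)) {r : Fin M → ℝ}
    (hr : ∀ j, r j ∈ Set.Icc (0 : ℝ) 1) : ∑ j, p j * r j ∈ Set.Icc (0 : ℝ) 1 := by
  refine ⟨Finset.sum_nonneg fun j _ => mul_nonneg (hp.1 j) (hr j).1, ?_⟩
  rw [← hp.2]
  exact Finset.sum_le_sum fun j _ => mul_le_of_le_one_right (hp.1 j) (hr j).2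

theorem expectedBroad_mem_Icc (hs : 0 ≤ αsys) (hp : p ∈ stdSimplex ℝ (Fin M)) :
    ∀ r ∈ {r : ℝ | ∃ N : ℕ, 3 ≤ N ∧ ∃ G : SimpleGraph (Fin N), G.Connected ∧
      ∃ S : TargetSet (Fin N), r = ∑ j, p j * broadRisk G S αsys (α j)},
    r ∈ Set.Icc (0 : ℝ) 1 := by
  rintro _ ⟨N, -, G, hG, S, rfl⟩
  exact expected_mem_Icc hp fun j => broadRisk_mem_Icc_of_connected hs hG S _

theorem expectedFocused_mem_Icc (hs : 0 ≤ αsys) (hp : p ∈ stdSimplex ℝ (Fin M)) :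
    ∀ r ∈ {r : ℝ | ∃ N : ℕ, 3 ≤ N ∧ ∃ G : SimpleGraph (Fin N), G.Connected ∧
      ∃ F : FixedSet (Fin N), r = ∑ j, p j * focusedRisk G F αsys (α j)},
    r ∈ Set.Icc (0 : ℝ) 1 := by
  rintro _ ⟨N, -, G, hG, F, rfl⟩
  exact expected_mem_Icc hp fun j => focusedRisk_mem_Icc_of_connected hs hG F _

theorem worstExpectedBroad_mem_Icc (hs : 0 ≤ αsys) (hp : p ∈ stdSimplex ℝ (Fin M)) :
    worstExpectedBroad αsys α p ∈ Set.Icc (0 : ℝ) 1 :=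
  sSup_mem_Icc (expectedBroad_mem_Icc hs hp)

theorem worstExpectedFocused_mem_Icc (hs : 0 ≤ αsys) (hp : p ∈ stdSimplex ℝ (Fin M)) :
    worstExpectedFocused αsys α p ∈ Set.Icc (0 : ℝ) 1 :=
  sSup_mem_Icc (expectedFocused_mem_Icc hs hp)

theorem sum_ite_mul_le {q : Fin M → Prop} [DecidablePred q] (hp : p ∈ stdSimplex ℝ (Fin M))
    {r : Fin M → ℝ} {c : ℝ} (hr : ∀ j, 0 ≤ r j) (hc : ∀ j, q j → c ≤ r j) :
    (∑ j, if q j then p j else 0) * c ≤ ∑ j, p j * r j := by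
  rw [Finset.sum_mul]
  refine Finset.sum_le_sum fun j _ => ?_
  split_ifs with h
  · exact mul_le_mul_of_nonneg_left (hc j h) (hp.1 j)
  · rw [zero_mul]; exact mul_nonneg (hp.1 j) (hr j)

theorem sum_ite_nonneg {q : Fin M → Prop} [DecidablePred q] (hp : ∀ j, 0 ≤ p j) :
    0 ≤ ∑ j, if q j then p j else 0 :=
  Finset.sum_nonneg fun j _ => by split_ifs <;> simp [hp j]

/-- A broad attack that is worst for the gain `α i` is at least as bad for all smaller gains. -/
theorem sum_mul_worstBroad_le (hs : 0 ≤ αsys) (hα : Monotone α) (hpos : ∀ i, 0 < α i)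
    (hp : p ∈ stdSimplex ℝ (Fin M)) (i : Fin M) :
    (∑ j, if j ≤ i then p j else 0) * worstBroad αsys (α i) ≤ worstExpectedBroad αsys α p := by
  refine mul_sSup_le (sum_ite_nonneg hp.1) (worstExpectedBroad_mem_Icc hs hp).1 ?_
  rintro _ ⟨N, hN, G, hG, S, rfl⟩
  obtain ⟨N', hN', G', hG', S', h⟩ := exists_broadRisk_le hN hG S hs (hpos i)
  refine le_trans (sum_ite_mul_le hp (r := fun j => broadRisk G' S' αsys (α j))
    (fun j => (broadRisk_mem_Icc_of_connected hs hG' S' _).1)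
    fun j hj => h _ (hpos j).le (hα hj)) ?_
  exact le_csSup ⟨1, fun r hr => (expectedBroad_mem_Icc hs hp r hr).2⟩
    ⟨N', hN', G', hG', S', rfl⟩

/-- A focused attack that is worst for the gain `α i` is at least as bad for all larger gains. -/
theorem sum_mul_worstFocused_le (hs : 0 ≤ αsys) (hα : Monotone α) (hle : ∀ i, αsys ≤ α i)
    (hp : p ∈ stdSimplex ℝ (Fin M)) (i : Fin M) :
    (∑ j, if i ≤ j then p j else 0) * worstFocused αsys (α i) ≤
      worstExpectedFocused αsys α p := by
  refine mul_sSup_le (sum_ite_nonneg hp.1) (worstExpectedFocused_mem_Icc hs hp).1 ?_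
  rintro _ ⟨N, hN, G, hG, F, rfl⟩
  have := hG.nonempty
  refine le_trans (sum_ite_mul_le hp (r := fun j => focusedRisk G F αsys (α j))
    (fun j => (focusedRisk_mem_Icc G F hs _).1)
    fun j hj => focusedRisk_mono G F hs (hle i) (hα hj)) ?_
  exact le_csSup ⟨1, fun r hr => (expectedFocused_mem_Icc hs hp r hr).2⟩
    ⟨N, hN, G, hG, F, rfl⟩

end Worst

/-! ### The linear program. -/

section LinearProgram

variable {M : ℕ} {αsys γ : ℝ} {α : Fin M → ℝ}

theorem mem_feasible_iff (q : (Fin M → ℝ) × ℝ) : q ∈ feasible αsys γ α ↔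
    q.1 ∈ stdSimplex ℝ (Fin M) ∧ q.2 ∈ Set.Icc (0 : ℝ) 1 ∧
      (∀ i, (∑ j, if j ≤ i then q.1 j else 0) * worstBroad αsys (α i) ≤ q.2) ∧
      ∀ i, (∑ j, if i ≤ j then q.1 j else 0) * worstFocused αsys (α i) ≤ γ := by
  have hb : ∀ i, Matrix.mulVec (Ab αsys α) q.1 i =
      (∑ j, if j ≤ i then q.1 j else 0) * worstBroad αsys (α i) := by
    intro i
    simp only [Matrix.mulVec, dotProduct, Ab, Matrix.of_apply, Finset.sum_mul]
    refine Finset.sum_congr rfl fun j _ => ?_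
    split_ifs <;> ring
  have hf : ∀ i, Matrix.mulVec (Af αsys α) q.1 i =
      (∑ j, if i ≤ j then q.1 j else 0) * worstFocused αsys (α i) := by
    intro i
    simp only [Matrix.mulVec, dotProduct, Af, Matrix.of_apply, Finset.sum_mul]
    refine Finset.sum_congr rfl fun j _ => ?_
    split_ifs <;> ring
  have h1 : ∀ i : Fin M, Matrix.mulVec (Matrix.of fun (_ : Fin M) (_ : Unit) => (-1 : ℝ))
      (fun _ => q.2) i = -q.2 := by
    intro i
    simp [Matrix.mulVec, dotProduct]
  simp only [feasible, ALP, Set.mem_ofPred_eq, Matrix.fromBlocks_mulVec, Pi.le_def, Sum.forall,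
    Sum.elim_inl, Sum.elim_inr, Function.comp_def, Pi.add_apply, Matrix.zero_mulVec,
    add_zero, hb, hf, h1, stdSimplex]
  constructor
  · rintro ⟨h1, h2, h3, h4, h5⟩
    exact ⟨⟨h2, h1⟩, h3, fun i => by linarith [h4 i], h5⟩
  · rintro ⟨⟨h2, h1⟩, h3, h4, h5⟩
    exact ⟨h1, h2, h3, fun i => by linarith [h4 i], h5⟩

theorem isCompact_feasible : IsCompact (feasible αsys γ α) := by
  refine ((isCompact_stdSimplex ℝ (Fin M)).prod
    (isCompact_Icc (a := (0 : ℝ)) (b := 1))).of_isClosed_subset ?_ fun q hq => ?_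
  · have : feasible αsys γ α = {q | q.1 ∈ stdSimplex ℝ (Fin M)} ∩ ({q | q.2 ∈ Set.Icc (0 : ℝ) 1} ∩
        ((⋂ i, {q | (∑ j, if j ≤ i then q.1 j else 0) * worstBroad αsys (α i) ≤ q.2}) ∩
        ⋂ i, {q | (∑ j, if i ≤ j then q.1 j else 0) * worstFocused αsys (α i) ≤ γ})) := by
      ext q
      rw [mem_feasible_iff]
      simp
    rw [this]
    have hite : ∀ (P : Prop) [Decidable P] (j : Fin M),
        Continuous fun q : (Fin M → ℝ) × ℝ => if P then q.1 j else 0 := by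
      intro P _ j
      split_ifs <;> fun_prop
    refine ((isClosed_stdSimplex ℝ (Fin M)).preimage continuous_fst).inter
      ((isClosed_Icc.preimage continuous_snd).inter ((isClosed_iInter fun i => ?_).inter
        (isClosed_iInter fun i => ?_)))
    · exact isClosed_le ((continuous_finsetSum _ fun j _ => hite _ j).mul continuous_const)
        continuous_snd
    · exact isClosed_le ((continuous_finsetSum _ fun j _ => hite _ j).mul continuous_const)
        continuous_const
  · rw [mem_feasible_iff] at hq
    exact ⟨hq.1, hq.2.1⟩

/-- All mass on the smallest gain with `v = 1`: only the first row of `Af` sees this mass, and its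
bound is exactly `hγ`. -/
theorem feasible_nonempty [NeZero M] (hs : 0 ≤ αsys) (hγ : worstFocused αsys (α 0) ≤ γ) :
    (feasible αsys γ α).Nonempty := by
  have hp : Pi.single 0 1 ∈ stdSimplex ℝ (Fin M) := single_mem_stdSimplex ℝ 0
  refine ⟨(Pi.single 0 1, 1), (mem_feasible_iff _).2 ⟨hp, by simp, fun i => ?_, fun i => ?_⟩⟩
  · have h1 := worstBroad_mem_Icc hs (α i)
    refine mul_le_one₀ (le_trans ?_ hp.2.le) h1.1 h1.2
    refine Finset.sum_le_sum fun j _ => ?_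
    split_ifs
    · rfl
    · exact hp.1 j
  · by_cases hi : i = 0
    · subst hi
      have : (∑ j, if (0 : Fin M) ≤ j then (Pi.single 0 1 : Fin M → ℝ) j else 0) = 1 := by
        simp
      rwa [this, one_mul]
    · have : (∑ j, if i ≤ j then (Pi.single 0 1 : Fin M → ℝ) j else 0) = 0 := by
        refine Finset.sum_eq_zero fun j _ => ?_
        split_ifs with h
        · have hj : j ≠ 0 := by
            rintro rfl
            exact hi (nonpos_iff_eq_zero.1 h)
          simp [hj]
        · rfl
      rw [this, zero_mul]
      exact (worstFocused_nonneg hs _).trans hγ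

theorem isLeast_vb [NeZero M] (hs : 0 ≤ αsys) (hγ : worstFocused αsys (α 0) ≤ γ) :
    IsLeast (objectiveValues αsys γ α) (vb αsys γ α) :=
  (isCompact_feasible.image continuous_snd).isLeast_sInf ((feasible_nonempty hs hγ).image _)

theorem objectiveValues_mono {γ' : ℝ} (h : γ ≤ γ') :
    objectiveValues αsys γ α ⊆ objectiveValues αsys γ' α := by
  refine Set.image_mono fun q hq => ?_
  rw [mem_feasible_iff] at hq ⊢
  exact ⟨hq.1, hq.2.1, hq.2.2.1, fun i => (hq.2.2.2 i).trans h⟩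

end LinearProgram

end CoordGame

theorem corollary3 (αsys : ℝ) (hsys : 0 < αsys) (M : ℕ) [NeZero M] (α : Fin M → ℝ)
    (hα : StrictMono α) (hα₁ : αsys ≤ α 0) :
    (∀ γ ∈ Set.Icc (CoordGame.worstFocused αsys (α 0)) 1,
      IsLeast (CoordGame.objectiveValues αsys γ α) (CoordGame.vb αsys γ α) ∧
      ∀ p ∈ stdSimplex ℝ (Fin M), CoordGame.worstExpectedFocused αsys α p ≤ γ →
        CoordGame.vb αsys γ α ≤ CoordGame.worstExpectedBroad αsys α p) ∧
    AntitoneOn (fun γ => CoordGame.vb αsys γ α)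
      (Set.Icc (CoordGame.worstFocused αsys (α 0)) 1) := by
  have hle : ∀ i, αsys ≤ α i := fun i => hα₁.trans (hα.monotone (zero_le))
  refine ⟨fun γ hγ => ⟨CoordGame.isLeast_vb hsys.le hγ.1, fun p hp hpγ => ?_⟩,
    fun γ hγ γ' hγ' h => ?_⟩
  · refine (CoordGame.isLeast_vb hsys.le hγ.1).2
      ⟨(p, CoordGame.worstExpectedBroad αsys α p), (CoordGame.mem_feasible_iff _).2 ⟨hp, ?_, ?_, ?_⟩,
        rfl⟩
    · exact CoordGame.worstExpectedBroad_mem_Icc hsys.le hp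
    · exact CoordGame.sum_mul_worstBroad_le hsys.le hα.monotone
        (fun i => hsys.trans_le (hle i)) hp
    · exact fun i => (CoordGame.sum_mul_worstFocused_le hsys.le hα.monotone hle hp i).trans hpγ
  · exact (CoordGame.isLeast_vb hsys.le hγ'.1).2
      (CoordGame.objectiveValues_mono h (CoordGame.isLeast_vb hsys.le hγ.1).1)
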